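/- Let $R$ be a real closed field, with its ordering. Let $R\langle\langle X\rangle\rangle=\bigcup_{m\ge 1}R((X^{1/m}))$ be the field of Puiseux (fractional power) series over $R$, and let $R\langle\langle X\rangle\rangle^{alg}\subseteq R\langle\langle X\rangle\rangle$ be the subfield of those Puiseux series that are algebraic over the field of rational functions $R(X)$. Order $R\langle\langle X\rangle\rangle^{alg}$ as follows: a nonzero element can be written $\alpha=X^{m/n}(a_0+a_1X^{1/n}+\cdots)$ with $n>0$, $m\in\mathbb Z$, $a_i\in R$, $a_0\neq 0$, and $\alpha$ is positive if and only if its initial coefficient $a_0$ is positive in $R$; put $\alpha<\beta$ if and only if $\beta-\alpha$ is positive. Then $R\langle\langle X\rangle\rangle^{alg}$ is an ordered field with this order, and it is real closed. In particular: 1. for every $\alpha\in R\langle\langle X\rangle\rangle^{alg}$ there is $\beta\in R\langle\langle X\rangle\rangle^{alg}$ with $\beta^2=\alpha$ or $-\beta^2=\alpha$; 2. every monic polynomial of odd degree with coefficients in $R\langle\langle X\rangle\rangle^{alg}$ has a root in $R\langle\langle X\rangle\rangle^{alg}$. -/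

import Mathlib

noncomputable section

/-- The embedding of the Laurent series field `K((T))` into the Hahn series field `K⟦ℚ⟧` (formal
series in `X` with rational exponents) which sends `T` to `X^(1/m)`, that is,
`∑ aₙ Tⁿ ↦ ∑ aₙ X^(n/m)`. -/
def laurentRoot (K : Type*) [Field K] (m : ℕ+) : HahnSeries ℤ K →+* HahnSeries ℚ K :=
  HahnSeries.embDomainRingHom
    ((AddMonoidHom.mulRight ((m : ℚ)⁻¹)).comp (Int.castAddHom ℚ))
    (fun a b h => by
      have hm : ((m : ℚ)⁻¹) ≠ 0 := by simp
      have h' : (a : ℚ) * (m : ℚ)⁻¹ = (b : ℚ) * (m : ℚ)⁻¹ := h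
      exact_mod_cast mul_right_cancel₀ hm h')
    (fun a b => by
      have hm : (0 : ℚ) < (m : ℚ)⁻¹ := inv_pos.mpr (by exact_mod_cast m.pos)
      change (a : ℚ) * (m : ℚ)⁻¹ ≤ (b : ℚ) * (m : ℚ)⁻¹ ↔ a ≤ b
      rw [mul_le_mul_iff_left₀ hm]
      exact_mod_cast Iff.rfl)

/-- The field `K((X^(1/m)))`, as a subfield of `K⟦ℚ⟧`. -/
def laurentRootField (K : Type*) [Field K] (m : ℕ+) : Subfield (HahnSeries ℚ K) :=
  (laurentRoot K m).fieldRange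

/-- `K((X^(1/m))) ⊆ K((X^(1/(mk))))`. -/
theorem laurentRootField_le_mul (K : Type*) [Field K] (m k : ℕ+) :
    laurentRootField K m ≤ laurentRootField K (m * k) := by
  rintro _ ⟨f, rfl⟩
  let g : ℤ ↪o ℤ := OrderEmbedding.ofStrictMono (fun n => n * (k : ℤ))
    (fun a b h => mul_lt_mul_of_pos_right h (by exact_mod_cast k.pos))
  refine ⟨HahnSeries.embDomain g f, ?_⟩
  have hk : ((k : ℕ) : ℚ) ≠ 0 := by exact_mod_cast k.ne_zero
  have hm : ((m : ℕ) : ℚ) ≠ 0 := by exact_mod_cast m.ne_zero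
  ext q
  change (HahnSeries.embDomain _ (HahnSeries.embDomain g f)).coeff q
    = (HahnSeries.embDomain _ f).coeff q
  by_cases hq : ∃ n : ℤ, (n : ℚ) * ((m : ℕ) : ℚ)⁻¹ = q
  · obtain ⟨n, rfl⟩ := hq
    have e : (n : ℚ) * ((m : ℕ) : ℚ)⁻¹
        = ((n * (k : ℤ) : ℤ) : ℚ) * (((m * k : ℕ+) : ℕ) : ℚ)⁻¹ := by
      push_cast
      field_simp
    trans f.coeff n
    · rw [e]
      exact HahnSeries.embDomain_coeff.trans (HahnSeries.embDomain_coeff (f := g) (a := n))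
    · exact HahnSeries.embDomain_coeff.symm
  · refine Eq.trans ?_ (HahnSeries.embDomain_of_notMem_range (b := q) (by
      rintro ⟨n, hn⟩
      exact hq ⟨n, hn⟩)).symm
    by_contra hne
    obtain ⟨b, hb, hbq⟩ := HahnSeries.support_embDomain_subset ((HahnSeries.mem_support _ _).mpr hne)
    obtain ⟨n, hn, rfl⟩ := HahnSeries.support_embDomain_subset hb
    refine hq ⟨n, ?_⟩
    rw [← hbq]
    change (n : ℚ) * ((m : ℕ) : ℚ)⁻¹
      = ((n * (k : ℤ) : ℤ) : ℚ) * (((m * k : ℕ+) : ℕ) : ℚ)⁻¹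
    push_cast
    field_simp

/-- The field `K⟨⟨X⟩⟩ = ⋃_{m ≥ 1} K((X^(1/m)))` of Puiseux series over `K`. -/
def puiseuxField (K : Type*) [Field K] : Subfield (HahnSeries ℚ K) where
  carrier := ⋃ m : ℕ+, (laurentRootField K m : Set (HahnSeries ℚ K))
  zero_mem' := Set.mem_iUnion.mpr ⟨1, zero_mem (laurentRootField K 1)⟩
  one_mem' := Set.mem_iUnion.mpr ⟨1, one_mem (laurentRootField K 1)⟩
  add_mem' := by
    intro a b ha hb
    obtain ⟨m, hm⟩ := Set.mem_iUnion.mp ha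
    obtain ⟨n, hn⟩ := Set.mem_iUnion.mp hb
    refine Set.mem_iUnion.mpr ⟨m * n, add_mem (laurentRootField_le_mul K m n hm) ?_⟩
    rw [mul_comm]
    exact laurentRootField_le_mul K n m hn
  mul_mem' := by
    intro a b ha hb
    obtain ⟨m, hm⟩ := Set.mem_iUnion.mp ha
    obtain ⟨n, hn⟩ := Set.mem_iUnion.mp hb
    refine Set.mem_iUnion.mpr ⟨m * n, mul_mem (laurentRootField_le_mul K m n hm) ?_⟩
    rw [mul_comm]
    exact laurentRootField_le_mul K n m hn
  neg_mem' := by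
    intro a ha
    obtain ⟨m, hm⟩ := Set.mem_iUnion.mp ha
    exact Set.mem_iUnion.mpr ⟨m, neg_mem hm⟩
  inv_mem' := by
    intro a ha
    obtain ⟨m, hm⟩ := Set.mem_iUnion.mp ha
    exact Set.mem_iUnion.mpr ⟨m, inv_mem hm⟩

/-- The type of Puiseux series over `K`. -/
abbrev PuiseuxSeries (K : Type*) [Field K] : Type _ := ↥(puiseuxField K)

/-- A monomial `c X^n` with integer exponent `n`, as a Puiseux series. -/
def PuiseuxSeries.monomial {K : Type*} [Field K] (n : ℤ) (c : K) : PuiseuxSeries K :=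
  ⟨HahnSeries.single (n : ℚ) c, Set.mem_iUnion.mpr ⟨1, HahnSeries.single n c, by
    refine HahnSeries.embDomain_single.trans ?_
    change HahnSeries.single ((n : ℚ) * (((1 : ℕ+) : ℕ) : ℚ)⁻¹) c = _
    simp⟩⟩

/-- The field `K(X)` of rational functions inside `K⟨⟨X⟩⟩`: the subfield generated by the
constants and by `X`. -/
def rationalFunctions (K : Type*) [Field K] : Subfield (PuiseuxSeries K) :=
  Subfield.closure (Set.range (PuiseuxSeries.monomial 0) ∪ {PuiseuxSeries.monomial 1 (1 : K)})

/-- The field `K⟨⟨X⟩⟩^alg` of the Puiseux series over `K` that are algebraic over `K(X)`. -/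
abbrev AlgPuiseuxSeries (K : Type*) [Field K] : Type _ :=
  ↥(algebraicClosure (rationalFunctions K) (PuiseuxSeries K))

/-- The initial coefficient of an algebraic Puiseux series: the coefficient of the smallest
exponent that occurs in it (and `0` for the zero series). -/
def AlgPuiseuxSeries.initialCoeff {K : Type*} [Field K] (α : AlgPuiseuxSeries K) : K :=
  ((α : PuiseuxSeries K) : HahnSeries ℚ K).leadingCoeff

/-- For an ordered field `K`, the order on `K⟨⟨X⟩⟩^alg` in which `α < β` when `α ≠ β` and the
initial coefficient of `β - α` is positive. -/
instance AlgPuiseuxSeries.instLinearOrder (K : Type*) [Field K] [LinearOrder K]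
    [IsStrictOrderedRing K] : LinearOrder (AlgPuiseuxSeries K) :=
  LinearOrder.lift' (fun α => toLex ((α : PuiseuxSeries K) : HahnSeries ℚ K))
    (fun _ _ h => Subtype.ext (Subtype.ext (toLex.injective h)))

end

open Polynomial IsLocalRing

/-! It suffices that nonnegative elements are squares and that odd-degree polynomials have roots.
Both are obtained among all Puiseux series and then descend, since a root of a polynomial with
algebraic coefficients is algebraic over `R(X)`. For odd degree, induct on the degree. A translation
kills the second coefficient, and a scaling by a power of `X` makes all coefficients integral with
some non-leading one a unit. Setting `X = 0` leaves a polynomial over `R` having a root of odd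
multiplicity. Weierstrass preparation lifts that multiplicity to a monic factor of the same odd
degree, and the two normalisations make this degree strictly smaller
(`PuiseuxSeries.exists_isRoot_of_odd`). Square roots come from Hensel's lemma after removing the
leading monomial. -/

/-! ### Monic factors over complete local rings -/

theorem PowerSeries.IsWeierstrassFactorization.dvd_of_coe {A : Type*} [CommRing A] [IsLocalRing A]
    [IsHausdorff (maximalIdeal A) A] {g P : A[X]} {h : PowerSeries A}
    (H : (g : PowerSeries A).IsWeierstrassFactorization P h) : P ∣ g := by
  have hP := H.isDistinguishedAt
  rw [← modByMonic_eq_zero_iff_dvd hP.monic]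
  have hI : maximalIdeal A ≠ ⊤ := Ideal.IsMaximal.ne_top inferInstance
  have hdeg : P.degree =
      ((P : PowerSeries A).map (Ideal.Quotient.mk (maximalIdeal A))).order.toNat := by
    have := congr(ENat.toNat $(hP.coe_natDegree_eq_order_map P 1
      (by rwa [map_one, ← Ideal.ne_top_iff_one]) (by simp)))
    rw [← this, degree_eq_natDegree hP.monic.ne_zero]
    simp
  -- Polynomial division of `g` by `P` and the factorization `g = P * h` are two Weierstrass
  -- divisions by `P`; uniqueness forces the remainder to vanish.
  refine (PowerSeries.IsWeierstrassDivisorAt.eq_of_mul_add_eq_mul_add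
    hP.isWeierstrassDivisorAt' (q := ((g /ₘ P : A[X]) : PowerSeries A)) (q' := h) (r' := 0)
    ((degree_modByMonic_lt g hP.monic).trans_eq hdeg) ?_ ?_).2
  · rw [degree_zero]; exact WithBot.bot_lt_coe _
  · rw [Polynomial.coe_zero, add_zero, ← H.eq_mul, ← Polynomial.coe_mul, ← Polynomial.coe_add,
      add_comm, modByMonic_add_div]

theorem PowerSeries.order_coe_eq_natTrailingDegree {K : Type*} [Semiring K] {p : K[X]}
    (hp : p ≠ 0) : (p : PowerSeries K).order = p.natTrailingDegree := by
  rw [PowerSeries.order_eq_nat]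
  refine ⟨?_, fun i hi => ?_⟩
  · rw [Polynomial.coeff_coe]
    exact trailingCoeff_nonzero_iff_nonzero.mpr hp
  · rw [Polynomial.coeff_coe]
    exact coeff_eq_zero_of_lt_natTrailingDegree hi

/-- A monic polynomial over a complete local ring has a monic divisor whose degree is the
multiplicity of a given root of the reduced polynomial. -/
theorem Polynomial.Monic.exists_monic_dvd_natDegree_eq_rootMultiplicity {A : Type*} [CommRing A]
    [IsLocalRing A] [IsAdicComplete (maximalIdeal A) A] {G : A[X]} (hG : G.Monic) (c : A) :
    ∃ P : A[X], P.Monic ∧ P ∣ G ∧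
      P.natDegree = (G.map (residue A)).rootMultiplicity (residue A c) := by
  -- Moving the root to `0` turns its multiplicity into the order of the reduced power series, which
  -- is the degree of the Weierstrass polynomial.
  have hgm : (G.comp (X + C c)).Monic := hG.comp_X_add_C c
  have hne : (G.comp (X + C c)).map (residue A) ≠ 0 := (hgm.map _).ne_zero
  obtain ⟨P, h, H⟩ := PowerSeries.exists_isWeierstrassFactorization
    (g := ((G.comp (X + C c) : A[X]) : PowerSeries A))
    (by rw [← polynomial_map_coe]; exact_mod_cast hne)
  obtain ⟨Q, hQ⟩ := H.dvd_of_coe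
  refine ⟨P.comp (X - C c), H.isDistinguishedAt.monic.comp_X_sub_C c, ⟨Q.comp (X - C c), ?_⟩, ?_⟩
  · rw [← mul_comp, ← hQ, comp_assoc]
    simp
  · rw [sub_eq_add_neg, ← C_neg, ← taylor_apply, natDegree_taylor, H.natDegree_eq_toNat_order_map,
      ← polynomial_map_coe, PowerSeries.order_coe_eq_natTrailingDegree hne,
      rootMultiplicity_eq_natTrailingDegree, Polynomial.map_comp]
    simp

instance PowerSeries.isAdicComplete_maximalIdeal (K : Type*) [Field K] :
    IsAdicComplete (maximalIdeal (PowerSeries K)) (PowerSeries K) := by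
  rw [PowerSeries.maximalIdeal_eq_span_X]
  infer_instance

theorem PowerSeries.exists_monic_dvd_natDegree_eq_rootMultiplicity {K : Type*} [Field K]
    {G : (PowerSeries K)[X]} (hG : G.Monic) (c : K) :
    ∃ P : (PowerSeries K)[X], P.Monic ∧ P ∣ G ∧
      P.natDegree = (G.map PowerSeries.constantCoeff).rootMultiplicity c := by
  obtain ⟨P, hP, hd, he⟩ := hG.exists_monic_dvd_natDegree_eq_rootMultiplicity (PowerSeries.C c)
  refine ⟨P, hP, hd, ?_⟩
  rw [he, eq_rootMultiplicity_map (f := (residueFieldOfPowerSeries (k := K)).toRingHom)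
    (residueFieldOfPowerSeries (k := K)).injective, Polynomial.map_map]
  have : (residueFieldOfPowerSeries (k := K)).toRingHom.comp (residue (PowerSeries K))
      = PowerSeries.constantCoeff := by
    ext f; rfl
  rw [this]
  congr 1

/-! ### Normalising a polynomial of odd degree -/

/-- Over a real closed field, a polynomial of odd degree has a root of odd multiplicity. -/
theorem IsRealClosed.exists_odd_rootMultiplicity {R : Type*} [Field R] [IsRealClosed R] (p : R[X])
    (hp : Odd p.natDegree) : ∃ c, Odd (p.rootMultiplicity c) := by
  induction hn : p.natDegree using Nat.strong_induction_on generalizing p with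
  | h n ih =>
    obtain ⟨c, hc⟩ := exists_isRoot_of_odd_natDegree hp
    have hp0 : p ≠ 0 := by rintro rfl; simp at hp
    by_cases ho : Odd (p.rootMultiplicity c)
    · exact ⟨c, ho⟩
    obtain ⟨q, hq, hqc⟩ := exists_eq_pow_rootMultiplicity_mul_and_not_dvd p hp0 c
    have hpos := (rootMultiplicity_pos hp0).mpr hc
    set e := p.rootMultiplicity c
    have hq0 : q ≠ 0 := by rintro rfl; simp at hqc
    have hdeg : p.natDegree = e + q.natDegree := by
      conv_lhs => rw [hq]
      rw [natDegree_mul (pow_ne_zero _ (X_sub_C_ne_zero c)) hq0]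
      simp
    -- Removing a root of even multiplicity keeps the degree odd.
    obtain ⟨d, hd⟩ := ih q.natDegree (by omega) q (by grind) rfl
    have hdr : q.IsRoot d := (rootMultiplicity_pos hq0).mp hd.pos
    have hdc : d ≠ c := by
      rintro rfl
      exact hqc (dvd_iff_isRoot.mpr hdr)
    refine ⟨d, ?_⟩
    rw [hq, rootMultiplicity_mul (hq ▸ hp0), rootMultiplicity_eq_zero, zero_add]
    · exact hd
    · simpa [sub_eq_zero] using fun h => absurd h hdc

/-- In characteristic zero, a translation removes the second coefficient of a monic polynomial. -/
theorem Polynomial.Monic.exists_coeff_taylor_eq_zero {K : Type*} [Field K] [CharZero K] {f : K[X]}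
    {n : ℕ} (hf : f.Monic) (hn : f.natDegree = n + 1) : ∃ c, (taylor c f).coeff n = 0 := by
  refine ⟨-(f.coeff n / (n + 1)), ?_⟩
  -- The `n`-th Hasse derivative is linear, with value `f.coeff n + (n + 1) * c` at `c`.
  rw [taylor_coeff, eval_eq_sum_range' (n := 2), Finset.sum_range_succ, Finset.sum_range_one,
    hasseDeriv_coeff, hasseDeriv_coeff]
  · have h1 : f.coeff (1 + n) = 1 := by rw [add_comm, ← hn]; exact hf
    have hne : (n : K) + 1 ≠ 0 := by exact_mod_cast n.succ_ne_zero
    rw [h1, add_comm 1 n, Nat.choose_succ_self_right]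
    simp
    field_simp
    ring
  · have := natDegree_hasseDeriv_le f n
    omega

/-- Rescaling by the slope of the first edge of the Newton polygon. -/
theorem HahnSeries.exists_integral_scaling {K : Type*} [Field K] (a : ℕ → HahnSeries ℚ K) (n : ℕ)
    (ha : ∃ i < n, a i ≠ 0) : ∃ r : ℚ,
      (∀ i < n, ∀ q < 0, (a i * single r 1 ^ (n - i)).coeff q = 0) ∧
      ∃ i < n, (a i * single r 1 ^ (n - i)).coeff 0 ≠ 0 := by
  classical
  -- Scaling adds `(n - i) * r` to the order of `a i`; taking `-r` to be the least ratio makes all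
  -- these orders nonnegative, and zero at the minimiser.
  obtain ⟨j, hj, hmin⟩ := Finset.exists_min_image {i ∈ Finset.range n | a i ≠ 0}
    (fun i => (a i).order / ((n - i : ℕ) : ℚ))
    (by obtain ⟨i, hi, h⟩ := ha; exact ⟨i, by simp [hi, h]⟩)
  simp only [Finset.mem_filter, Finset.mem_range] at hj hmin
  have key (i : ℕ) (r q : ℚ) : (a i * single r 1 ^ (n - i)).coeff q
      = (a i).coeff (q - (n - i : ℕ) * r) := by
    rw [single_pow, one_pow, nsmul_eq_mul]
    conv_lhs => rw [← sub_add_cancel q ((n - i : ℕ) * r)]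
    rw [coeff_mul_single_add, mul_one]
  have hpos {i : ℕ} (hi : i < n) : (0 : ℚ) < (n - i : ℕ) := by
    exact_mod_cast Nat.sub_pos_of_lt hi
  refine ⟨-((a j).order / ((n - j : ℕ) : ℚ)), fun i hi q hq => ?_, j, hj.1, ?_⟩
  · rw [key]
    by_cases hai : a i = 0
    · simp [hai]
    refine coeff_eq_zero_of_lt_order ?_
    have := hmin i ⟨hi, hai⟩
    rw [le_div_iff₀ (hpos hi)] at this
    linarith
  · rw [key]
    have : 0 - ((n - j : ℕ) : ℚ) * -((a j).order / ((n - j : ℕ) : ℚ)) = (a j).order := by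
      field_simp [(hpos hj.1).ne']
      ring
    rw [this, ← leadingCoeff_eq]
    exact leadingCoeff_ne_zero.mpr hj.2

/-! ### Integral Puiseux series as power series in a root of `X` -/

section Puiseux

variable {K : Type*} [Field K]

theorem laurentRoot_coeff (m : ℕ+) (f : HahnSeries ℤ K) (n : ℤ) :
    (laurentRoot K m f).coeff ((n : ℚ) * ((m : ℕ) : ℚ)⁻¹) = f.coeff n :=
  HahnSeries.embDomain_coeff

theorem mem_puiseuxField_iff {a : HahnSeries ℚ K} :
    a ∈ puiseuxField K ↔ ∃ m, a ∈ laurentRootField K m :=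
  Set.mem_iUnion

/-- The embedding `K⟦T⟧ → K⟨⟨X⟩⟩` sending `T` to `X^(1/m)`. -/
noncomputable def PuiseuxSeries.ofPowerSeriesRoot (K : Type*) [Field K] (m : ℕ+) :
    PowerSeries K →+* PuiseuxSeries K :=
  ((laurentRoot K m).comp (HahnSeries.ofPowerSeries ℤ K)).codRestrict (puiseuxField K)
    fun _ => mem_puiseuxField_iff.mpr ⟨m, _, rfl⟩

theorem PuiseuxSeries.coe_ofPowerSeriesRoot (m : ℕ+) (p : PowerSeries K) :
    (ofPowerSeriesRoot K m p : HahnSeries ℚ K) = laurentRoot K m (HahnSeries.ofPowerSeries ℤ K p) :=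
  rfl

theorem PuiseuxSeries.coeff_zero_ofPowerSeriesRoot (m : ℕ+) (p : PowerSeries K) :
    (ofPowerSeriesRoot K m p : HahnSeries ℚ K).coeff 0 = PowerSeries.constantCoeff p := by
  have := laurentRoot_coeff m (HahnSeries.ofPowerSeries ℤ K p) 0
  rw [Int.cast_zero, zero_mul] at this
  rw [coe_ofPowerSeriesRoot, this]
  exact (HahnSeries.ofPowerSeries_apply_coeff p 0).trans (by simp)

theorem PuiseuxSeries.mem_range_ofPowerSeriesRoot {a : PuiseuxSeries K} {m : ℕ+}
    (ha : (a : HahnSeries ℚ K) ∈ laurentRootField K m)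
    (h : ∀ q < 0, (a : HahnSeries ℚ K).coeff q = 0) : ∃ p, ofPowerSeriesRoot K m p = a := by
  obtain ⟨f, hf⟩ := ha
  have hm : (0 : ℚ) < ((m : ℕ) : ℚ)⁻¹ := inv_pos.mpr (by exact_mod_cast m.pos)
  have hneg (n : ℤ) (hn : n < 0) : f.coeff n = 0 := by
    rw [← laurentRoot_coeff m, hf]
    exact h _ (mul_neg_of_neg_of_pos (by exact_mod_cast hn) hm)
  refine ⟨PowerSeries.mk fun n => f.coeff n, Subtype.ext ?_⟩
  rw [coe_ofPowerSeriesRoot, ← hf]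
  congr 1
  ext n
  obtain ⟨k, rfl | rfl⟩ := n.eq_nat_or_neg
  · exact (HahnSeries.ofPowerSeries_apply_coeff _ k).trans (by simp)
  · obtain rfl | hk := k.eq_zero_or_pos
    · simpa using
        (HahnSeries.ofPowerSeries_apply_coeff (Γ := ℤ) (PowerSeries.mk fun n => f.coeff n) 0)
    · rw [hneg _ (by omega), HahnSeries.ofPowerSeries_apply]
      refine HahnSeries.embDomain_of_notMem_range ?_
      rintro ⟨i, hi⟩
      have : (i : ℤ) = -k := hi
      omega

/-- A common denominator places the coefficients of a polynomial in one complete field; the union of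
these fields is not complete. -/
theorem exists_forall_mem_laurentRootField {ι : Type*} (s : Finset ι) (a : ι → PuiseuxSeries K) :
    ∃ m, ∀ i ∈ s, (a i : HahnSeries ℚ K) ∈ laurentRootField K m := by
  classical
  induction s using Finset.induction_on with
  | empty => exact ⟨1, by simp⟩
  | insert i s _ ih =>
    obtain ⟨m, hm⟩ := ih
    obtain ⟨k, hk⟩ := mem_puiseuxField_iff.mp (a i).2
    refine ⟨m * k, fun j hj => ?_⟩
    obtain rfl | hj := Finset.mem_insert.mp hj
    · rw [mul_comm]
      exact laurentRootField_le_mul K k m hk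
    · exact laurentRootField_le_mul K m k (hm j hj)

/-- The monomial `X^r` with rational exponent. -/
noncomputable def PuiseuxSeries.rpow (K : Type*) [Field K] (r : ℚ) : PuiseuxSeries K :=
  ⟨HahnSeries.single r 1, mem_puiseuxField_iff.mpr ⟨⟨r.den, r.pos⟩, HahnSeries.single r.num 1, by
    refine HahnSeries.embDomain_single.trans ?_
    change HahnSeries.single ((r.num : ℚ) * (r.den : ℚ)⁻¹) 1 = _
    rw [← div_eq_mul_inv, Rat.num_div_den]⟩⟩

theorem PuiseuxSeries.coe_rpow (r : ℚ) :
    (rpow K r : HahnSeries ℚ K) = HahnSeries.single r 1 := rfl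

theorem PuiseuxSeries.rpow_add (r s : ℚ) : rpow K (r + s) = rpow K r * rpow K s :=
  Subtype.ext (by
    change _ = (rpow K r : HahnSeries ℚ K) * (rpow K s : HahnSeries ℚ K)
    simp [coe_rpow])

theorem PuiseuxSeries.rpow_ne_zero (r : ℚ) : rpow K r ≠ 0 := fun h => by
  have : (rpow K r : HahnSeries ℚ K) = 0 := congrArg Subtype.val h
  simp [coe_rpow] at this

/-- A monic polynomial whose coefficients are integral Puiseux series comes from `K⟦X^(1/m)⟧`. -/
theorem PuiseuxSeries.exists_lift {f : (PuiseuxSeries K)[X]} (hf : f.Monic)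
    (h : ∀ i, ∀ q < 0, (f.coeff i : HahnSeries ℚ K).coeff q = 0) :
    ∃ m, ∃ G : (PowerSeries K)[X], G.map (ofPowerSeriesRoot K m) = f ∧
      G.natDegree = f.natDegree ∧ G.Monic := by
  obtain ⟨m, hm⟩ := exists_forall_mem_laurentRootField f.support f.coeff
  refine ⟨m, lifts_and_natDegree_eq_and_monic ((lifts_iff_coeff_lifts _).mpr fun i => ?_) hf⟩
  by_cases hi : i ∈ f.support
  · exact mem_range_ofPowerSeriesRoot (hm i hi) (h i)
  · exact ⟨0, by rw [map_zero, notMem_support_iff.mp hi]⟩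

end Puiseux

/-! ### Roots of odd-degree polynomials and square roots -/

section RealClosed

variable {R : Type*} [Field R] [LinearOrder R] [IsStrictOrderedRing R] [IsRealClosed R]

theorem PuiseuxSeries.exists_isRoot_of_odd (f : (PuiseuxSeries R)[X]) (hf : f.Monic)
    (hodd : Odd f.natDegree) : ∃ y, f.IsRoot y := by
  induction hn : f.natDegree using Nat.strong_induction_on generalizing f with
  | h n ih =>
    obtain ⟨k, rfl⟩ : ∃ k, n = k + 1 :=
      Nat.exists_eq_succ_of_ne_zero (by rintro rfl; simp [hn] at hodd)
    have : CharZero (PuiseuxSeries R) :=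
      charZero_of_injective_ringHom (ofPowerSeriesRoot R 1 |>.comp PowerSeries.C).injective
    obtain ⟨c, hc⟩ := hf.exists_coeff_taylor_eq_zero hn
    suffices ∃ y, (taylor c f).IsRoot y by
      obtain ⟨y, hy⟩ := this
      exact ⟨y + c, by rwa [IsRoot, taylor_eval] at hy⟩
    have hgm : (taylor c f).Monic := hf.comp_X_add_C c
    have hgn : (taylor c f).natDegree = k + 1 := by rw [natDegree_taylor, hn]
    generalize taylor c f = g at hc hgm hgn
    by_cases h0 : ∀ i < k + 1, g.coeff i = 0
    · refine ⟨0, ?_⟩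
      rw [IsRoot, ← coeff_zero_eq_eval_zero]
      exact h0 0 k.succ_pos
    push Not at h0
    obtain ⟨r, hr, i, hi, hri⟩ := HahnSeries.exists_integral_scaling
      (fun i => (g.coeff i : HahnSeries ℚ R)) (k + 1)
      (by obtain ⟨i, hi, h⟩ := h0; exact ⟨i, hi, fun h' => h (Subtype.ext h')⟩)
    suffices ∃ y, (g.scaleRoots (rpow R r)).IsRoot y by
      obtain ⟨y, hy⟩ := this
      refine ⟨(rpow R r)⁻¹ * y, ?_⟩
      have := g.scaleRoots_eval_mul ((rpow R r)⁻¹ * y) (rpow R r)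
      rw [mul_inv_cancel_left₀ (rpow_ne_zero r), hy.eq_zero] at this
      exact (mul_eq_zero.mp this.symm).resolve_left (pow_ne_zero _ (rpow_ne_zero r))
    have hsm : (g.scaleRoots (rpow R r)).Monic := (monic_scaleRoots_iff _).mpr hgm
    have hsn : (g.scaleRoots (rpow R r)).natDegree = k + 1 := by rw [natDegree_scaleRoots, hgn]
    have hsk : (g.scaleRoots (rpow R r)).coeff k = 0 := by rw [coeff_scaleRoots, hc, zero_mul]
    have hcoe (i : ℕ) : ((g.scaleRoots (rpow R r)).coeff i : HahnSeries ℚ R)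
        = (g.coeff i : HahnSeries ℚ R) * HahnSeries.single r (1 : R) ^ (k + 1 - i) := by
      rw [coeff_scaleRoots, hgn]; rfl
    have hint (i : ℕ) (q : ℚ) (hq : q < 0) :
        ((g.scaleRoots (rpow R r)).coeff i : HahnSeries ℚ R).coeff q = 0 := by
      rcases lt_trichotomy i (k + 1) with h | rfl | h
      · rw [hcoe]; exact hr i h q hq
      · rw [← hsn, hsm.coeff_natDegree]
        exact (HahnSeries.coeff_one (a := q)).trans (if_neg hq.ne)
      · rw [coeff_eq_zero_of_natDegree_lt (by omega)]; rfl
    rw [← hcoe] at hri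
    generalize g.scaleRoots (rpow R r) = s at hsm hsn hsk hint hri
    obtain ⟨m, G, rfl, hGn, hGm⟩ := exists_lift hsm hint
    have hred (i : ℕ) : (G.map PowerSeries.constantCoeff).coeff i =
        ((G.map (ofPowerSeriesRoot R m)).coeff i : HahnSeries ℚ R).coeff 0 := by
      rw [coeff_map, coeff_map, coeff_zero_ofPowerSeriesRoot]
    have hpm : (G.map (PowerSeries.constantCoeff (R := R))).Monic := hGm.map _
    have hpn : (G.map (PowerSeries.constantCoeff (R := R))).natDegree = k + 1 := by
      rw [hGm.natDegree_map, hGn, hsn]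
    obtain ⟨d, hd⟩ := IsRealClosed.exists_odd_rootMultiplicity
      (G.map (PowerSeries.constantCoeff (R := R))) (by rw [hpn, ← hn]; exact hodd)
    obtain ⟨P, hP, ⟨Q, hQ⟩, hPn⟩ := PowerSeries.exists_monic_dvd_natDegree_eq_rootMultiplicity hGm d
    -- Full multiplicity would make the reduction `(X - C d) ^ (k + 1)`. Its vanishing coefficient
    -- in degree `k` gives `d = 0`, against the nonzero lower coefficient in `hri`.
    have hlt : P.natDegree < k + 1 := by
      rw [hPn, ← hpn]
      refine lt_of_le_of_ne (by
        simpa using natDegree_le_of_dvd (pow_rootMultiplicity_dvd _ d) hpm.ne_zero) fun he => ?_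
      have hpow : G.map (PowerSeries.constantCoeff (R := R)) = (X - C d) ^ (k + 1) := by
        refine (eq_of_monic_of_dvd_of_natDegree_le ((monic_X_sub_C d).pow _) hpm ?_ ?_)
        · rw [← hpn, ← he]; exact pow_rootMultiplicity_dvd _ _
        · simp [hpn]
      have hnext := (monic_X_sub_C d).nextCoeff_pow (k + 1)
      rw [← hpow, nextCoeff_of_natDegree_pos (by omega), hpn, Nat.add_sub_cancel, hred, hsk,
        nextCoeff_X_sub_C] at hnext
      have hd0 : d = 0 := by
        have h1 : ((k : R) + 1) ≠ 0 := by exact_mod_cast k.succ_ne_zero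
        have h2 : (0 : R) = ((k : R) + 1) * -d := by simpa using hnext
        simpa [h1] using h2
      rw [← hred, hpow, hd0, C_0, sub_zero, coeff_X_pow, if_neg hi.ne] at hri
      exact hri rfl
    obtain ⟨y, hy⟩ := ih P.natDegree hlt (P.map (ofPowerSeriesRoot R m)) (hP.map _)
      (by rw [hP.natDegree_map, hPn]; exact hd) (hP.natDegree_map _)
    refine ⟨y, ?_⟩
    rw [hQ, Polynomial.map_mul]
    exact root_mul_right_of_isRoot _ hy

theorem PuiseuxSeries.isSquare_of_leadingCoeff_pos {a : PuiseuxSeries R}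
    (ha : 0 < (a : HahnSeries ℚ R).leadingCoeff) : IsSquare a := by
  set q := (a : HahnSeries ℚ R).order
  have hcoe (t : ℚ) : ((a * rpow R (-q) : PuiseuxSeries R) : HahnSeries ℚ R).coeff t
      = (a : HahnSeries ℚ R).coeff (t + q) := by
    change ((a : HahnSeries ℚ R) * HahnSeries.single (-q) 1).coeff t = _
    conv_lhs => rw [← add_neg_cancel_right t q]
    rw [HahnSeries.coeff_mul_single_add, mul_one]
  obtain ⟨m, hm⟩ := mem_puiseuxField_iff.mp (a * rpow R (-q)).2
  obtain ⟨u, hu⟩ := mem_range_ofPowerSeriesRoot hm fun t ht => by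
    rw [hcoe]
    exact HahnSeries.coeff_eq_zero_of_lt_order (by linarith)
  have hu0 : 0 < PowerSeries.constantCoeff u := by
    rwa [← coeff_zero_ofPowerSeriesRoot m, hu, hcoe, zero_add, ← HahnSeries.leadingCoeff_eq]
  obtain ⟨b, hb⟩ := IsSquare.of_nonneg hu0.le
  have hb0 : b ≠ 0 := by rintro rfl; simp [hb] at hu0
  -- The root `b` of the reduction is simple: the derivative there is `2 * b`, nonzero.
  obtain ⟨v, hv, -⟩ := (inferInstance : HenselianRing (PowerSeries R) (maximalIdeal _)).is_henselian
    (X ^ 2 - C u) (monic_X_pow_sub_C u two_ne_zero) (PowerSeries.C b)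
    (by
      rw [← PowerSeries.ker_coeff_eq_max_ideal, RingHom.mem_ker]
      simp [hb, sq])
    (by
      refine IsUnit.map _ ?_
      rw [PowerSeries.isUnit_iff_constantCoeff]
      simp [hb0])
  have hv2 : v ^ 2 = u := by simpa [sub_eq_zero] using hv
  refine ⟨ofPowerSeriesRoot R m v * rpow R (q / 2), ?_⟩
  have h1 : rpow R (q / 2) * rpow R (q / 2) = rpow R q := by rw [← rpow_add, add_halves]
  have h2 : rpow R (-q) * rpow R q = 1 := by
    rw [← rpow_add, neg_add_cancel]; rfl
  rw [mul_mul_mul_comm, h1, ← map_mul, ← sq, hv2, hu, mul_assoc, h2, mul_one]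

end RealClosed

/-! ### Descent to algebraic Puiseux series -/

theorem mem_algebraicClosure_of_isAlgebraic {F E : Type*} [Field F] [Field E] [Algebra F E] {y : E}
    (hy : IsAlgebraic (algebraicClosure F E) y) : y ∈ algebraicClosure F E :=
  mem_algebraicClosure_iff.mpr (hy.restrictScalars F)

namespace AlgPuiseuxSeries

variable {R : Type*} [Field R]

theorem exists_isRoot_of_isRoot_map {F : (AlgPuiseuxSeries R)[X]} (hF : F ≠ 0) {y : PuiseuxSeries R}
    (hy : (F.map (algebraMap (AlgPuiseuxSeries R) (PuiseuxSeries R))).IsRoot y) :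
    ∃ z, F.IsRoot z := by
  have hy' : IsAlgebraic (AlgPuiseuxSeries R) y :=
    ⟨F, hF, by rwa [IsRoot, eval_map_algebraMap] at hy⟩
  have hmem : y ∈ algebraicClosure (rationalFunctions R) (PuiseuxSeries R) :=
    mem_algebraicClosure_of_isAlgebraic hy'
  exact ⟨⟨y, hmem⟩, hy.of_map (x := (⟨y, hmem⟩ : AlgPuiseuxSeries R))
    (algebraMap (AlgPuiseuxSeries R) (PuiseuxSeries R)).injective⟩

variable [LinearOrder R] [IsStrictOrderedRing R]

/-- The inclusion of the algebraic Puiseux series in the lexicographically ordered Hahn series. -/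
def toLexHahnSeries (α : AlgPuiseuxSeries R) : Lex (HahnSeries ℚ R) :=
  toLex ((α : PuiseuxSeries R) : HahnSeries ℚ R)

instance : IsStrictOrderedRing (AlgPuiseuxSeries R) :=
  Function.Injective.isStrictOrderedRing toLexHahnSeries rfl rfl (fun _ _ => rfl) (fun _ _ => rfl)
    Iff.rfl Iff.rfl

theorem pos_iff_initialCoeff_pos (α : AlgPuiseuxSeries R) : 0 < α ↔ 0 < α.initialCoeff :=
  (HahnSeries.leadingCoeff_pos_iff (x := α.toLexHahnSeries)).symm

variable [IsRealClosed R]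

theorem isSquare_of_nonneg {α : AlgPuiseuxSeries R} (h : 0 ≤ α) : IsSquare α := by
  obtain rfl | h := h.eq_or_lt
  · exact IsSquare.zero
  obtain ⟨y, hy⟩ := PuiseuxSeries.isSquare_of_leadingCoeff_pos
    (a := (α : PuiseuxSeries R)) ((pos_iff_initialCoeff_pos α).mp h)
  obtain ⟨z, hz⟩ := exists_isRoot_of_isRoot_map (F := X ^ 2 - C α) (y := y)
    (monic_X_pow_sub_C α two_ne_zero).ne_zero
    (by
      have : (algebraMap (AlgPuiseuxSeries R) (PuiseuxSeries R)) α = y * y := hy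
      simp [this, sq])
  exact ⟨z, by simpa [sub_eq_zero, sq, eq_comm] using hz⟩

theorem exists_isRoot_of_odd_natDegree {F : (AlgPuiseuxSeries R)[X]} (hF : Odd F.natDegree) :
    ∃ y, F.IsRoot y := by
  have hF0 : F ≠ 0 := by rintro rfl; simp at hF
  -- The root theorem for Puiseux series needs a monic polynomial; normalising preserves the roots.
  let G := (F * C F.leadingCoeff⁻¹).map (algebraMap (AlgPuiseuxSeries R) (PuiseuxSeries R))
  have hmonic : (F * C F.leadingCoeff⁻¹).Monic := monic_mul_leadingCoeff_inv hF0
  obtain ⟨y, hy⟩ := PuiseuxSeries.exists_isRoot_of_odd G (hmonic.map _)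
    (by rwa [hmonic.natDegree_map, natDegree_mul_leadingCoeff_inv F hF0])
  obtain ⟨z, hz⟩ := exists_isRoot_of_isRoot_map hmonic.ne_zero hy
  refine ⟨z, ?_⟩
  simpa [hF0] using hz

instance : IsRealClosed (AlgPuiseuxSeries R) :=
  .of_linearOrderedField isSquare_of_nonneg exists_isRoot_of_odd_natDegree

end AlgPuiseuxSeries

theorem mainTheorem4 (R : Type*) [Field R] [LinearOrder R] [IsStrictOrderedRing R]
    [IsRealClosed R] :
    IsStrictOrderedRing (AlgPuiseuxSeries R) ∧
    (∀ α : AlgPuiseuxSeries R, 0 < α ↔ 0 < α.initialCoeff) ∧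
    IsRealClosed (AlgPuiseuxSeries R) ∧
    (∀ α : AlgPuiseuxSeries R, ∃ β : AlgPuiseuxSeries R, β ^ 2 = α ∨ -β ^ 2 = α) ∧
    (∀ F : Polynomial (AlgPuiseuxSeries R), F.Monic → Odd F.natDegree →
      ∃ y : AlgPuiseuxSeries R, F.IsRoot y) := by
  refine ⟨inferInstance, AlgPuiseuxSeries.pos_iff_initialCoeff_pos, inferInstance, fun α => ?_,
    fun F _ hF => AlgPuiseuxSeries.exists_isRoot_of_odd_natDegree hF⟩
  obtain ⟨β, hβ⟩ | ⟨β, hβ⟩ := IsRealClosed.isSquare_or_isSquare_neg α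
  · exact ⟨β, .inl (by rw [hβ, sq])⟩
  · exact ⟨β, .inr (by rw [sq, ← hβ, neg_neg])⟩
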